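/- Let $A=\mathbb{C}^d$ be a finite-dimensional quantum system with conserved charge a Hermitian operator $X$, let $U$ be a unitary on $A$, and write $\mathcal{U}(\rho)=U\rho U^\dagger$. Let $|x_1\rangle,|x_2\rangle$ be two orthogonal normalized eigenvectors of $X$ with $\langle x_1|UXU^\dagger|x_2\rangle\neq 0$. Definitions. An implementation of a map $\mathcal{E}$ on $A$ under the conservation law consists of complex Hilbert spaces $B,B'$ (of any dimension), self-adjoint operators $X_B$ on $B$ and $X_{B'}$ on $B'$ (possibly unbounded), a density operator $\rho_B$ on $B$ (the resource state) and a unitary $V:A\otimes B\to A\otimes B'$ such that $$V^\dagger(X\otimes 1+1\otimes X_{B'})V=X\otimes 1+1\otimes X_B\quad\text{and}\quad \mathcal{E}(\sigma)=\operatorname{Tr}_{B'}\!\left[V(\sigma\otimes\rho_B)V^\dagger\right]\ \text{ for all }\sigma .$$ The coherence of the resource state is its quantum Fisher information $$\mathcal{F}_{\rho_B}(X_B)=4\lim_{\epsilon\to0}\frac{D_F\!\left(e^{-i\epsilon X_B}\rho_Be^{i\epsilon X_B},\rho_B\right)^2}{\epsilon^2}\in[0,\infty],$$ read as a lower limit in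 case the limit does not exist, where $D_F(\rho,\sigma)=\sqrt{1-F(\rho,\sigma)^2}$ and $F(\rho,\sigma)=\operatorname{Tr}\sqrt{\sqrt{\sigma}\rho\sqrt{\sigma}}$. Claims. (1) Let $\mathcal{N}$ be any quantum channel (completely positive trace-preserving map) on $A$ with $\mathcal{N}(|x_j\rangle\langle x_j|)=|x_j\rangle\langle x_j|$ for $j=1,2$. Then the channel $\mathcal{N}\circ\mathcal{U}$ has no implementation under the conservation law with $\mathcal{F}_{\rho_B}(X_B)<\infty$; that is, it cannot be implemented exactly with a resource state of finite coherence. (2) An example is dephasing in a rotated basis: the map $\mathcal{D}(\rho)=\sum_\mu\Pi_\mu\rho\,\Pi_\mu$, where $\Pi_\mu$ is the orthogonal projection onto the eigenspace of $X$ for the eigenvalue $\mu$ and the sum runs over the distinct eigenvalues of $X$, is a channel that fixes $|x_1\rangle\langle x_1|$ and $|x_2\rangle\langle x_2|$, and $\mathcal{D}\circ\mathcal{U}$ cannot be implemented exactly, under the conservation law, with a resource state of finite coherence. -/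

import Mathlib

open scoped ENNReal Topology InnerProductSpace Matrix ComplexOrder

universe u v

noncomputable section

namespace ConservedChannel

/-! ### Channels on the finite-dimensional system `A = ℂ^a` -/

section Channels

variable {a : Type*}

/-- The amplification `id_k ⊗ N` of a linear map on matrices: `N` is applied to each block. -/
def amplify (k : ℕ) (N : Matrix a a ℂ →ₗ[ℂ] Matrix a a ℂ)
    (M : Matrix (Fin k × a) (Fin k × a) ℂ) : Matrix (Fin k × a) (Fin k × a) ℂ :=
  Matrix.of fun p q => N (Matrix.of fun x y => M (p.1, x) (q.1, y)) p.2 q.2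

/-- Quantum channels: completely positive, trace preserving linear maps on matrices. -/
structure IsChannel [Fintype a] (N : Matrix a a ℂ →ₗ[ℂ] Matrix a a ℂ) : Prop where
  completelyPositive : ∀ (k : ℕ) (M : Matrix (Fin k × a) (Fin k × a) ℂ),
    M.PosSemidef → (amplify k N M).PosSemidef
  tracePreserving : ∀ M : Matrix a a ℂ, (N M).trace = M.trace

/-- The rank-one operator `|x⟩⟨x|`. -/
def ketBra (x : a → ℂ) : Matrix a a ℂ := Matrix.vecMulVec x (star x)

/-- The map `ρ ↦ V ρ V†`. -/
def conjMap [Fintype a] (V : Matrix a a ℂ) : Matrix a a ℂ →ₗ[ℂ] Matrix a a ℂ where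
  toFun M := V * M * Vᴴ
  map_add' M M' := by rw [Matrix.mul_add, Matrix.add_mul]
  map_smul' c M := by simp

/-- The matrix of the orthogonal projection of `ℂ^a` onto the eigenspace `ker (X - μ)`. -/
def eigenProjection [Fintype a] [DecidableEq a] (X : Matrix a a ℂ) (μ : ℂ) : Matrix a a ℂ :=
  (Matrix.toEuclideanCLM (n := a) (𝕜 := ℂ)).symm
    (Module.End.eigenspace (Matrix.toEuclideanLin X) μ).starProjection

open scoped Classical in
/-- Dephasing with respect to the charge `X`: `ρ ↦ ∑ μ, Π_μ ρ Π_μ`, where `μ` runs over the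
(distinct) eigenvalues of `X` and `Π_μ` is the projection onto the eigenspace of `μ`. -/
def dephasing [Fintype a] [DecidableEq a] (X : Matrix a a ℂ) :
    Matrix a a ℂ →ₗ[ℂ] Matrix a a ℂ where
  toFun M := ∑ μ ∈ X.charpoly.roots.toFinset, eigenProjection X μ * M * eigenProjection X μ
  map_add' M M' := by simp only [Matrix.mul_add, Matrix.add_mul, Finset.sum_add_distrib]
  map_smul' c M := by simp [Finset.smul_sum]

end Channels

/-! ### Reservoirs: arbitrary complex Hilbert spaces -/

section Reservoir

variable (H : Type*) [NormedAddCommGroup H] [InnerProductSpace ℂ H] [CompleteSpace H]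

/-- An observable: a (possibly unbounded) self-adjoint operator `op`, given together with the
unitary group `unitaryGroup t = exp (i t op)`, i.e. the strongly continuous one-parameter unitary
group whose infinitesimal generator is `i op`. By Stone's theorem every self-adjoint operator
has exactly one such group, so an `Observable` is the same thing as a self-adjoint operator. -/
structure Observable where
  op : H →ₗ.[ℂ] H
  selfAdjoint : IsSelfAdjoint op
  unitaryGroup : ℝ → (H ≃ₗᵢ[ℂ] H)
  unitaryGroup_add : ∀ (s t : ℝ) (ψ : H),
    unitaryGroup (s + t) ψ = unitaryGroup s (unitaryGroup t ψ)
  unitaryGroup_continuous : ∀ ψ : H, Continuous fun t : ℝ => unitaryGroup t ψ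
  generator : ∀ ψ φ : H, (ψ, φ) ∈ op.graph ↔
    HasDerivAt (fun t : ℝ => unitaryGroup t ψ) (Complex.I • φ) 0

/-- An index set of an orthonormal basis of `H`. -/
def basisIndex : Set H := (exists_hilbertBasis ℂ H).choose

/-- A fixed orthonormal basis of `H`. Traces of trace-class operators do not depend on it. -/
def onb : HilbertBasis (basisIndex H) ℂ H := (exists_hilbertBasis ℂ H).choose_spec.choose

variable {H}

/-- States (density operators): positive operators of trace one. -/
structure IsState (ρ : H →L[ℂ] H) : Prop where
  isPositive : ρ.IsPositive
  trace_one : HasSum (fun k => ⟪onb H k, ρ (onb H k)⟫_ℂ) 1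

/-- The fidelity `F(ρ, σ) = Tr √(√σ ρ √σ)`. -/
def fidelity (ρ σ : H →L[ℂ] H) : ℝ :=
  ∑' k, (⟪onb H k, CFC.sqrt (CFC.sqrt σ * ρ * CFC.sqrt σ) (onb H k)⟫_ℂ).re

/-- The purified distance `D_F(ρ, σ) = √(1 - F(ρ, σ)²)`. -/
def purifiedDistance (ρ σ : H →L[ℂ] H) : ℝ := √(1 - fidelity ρ σ ^ 2)

/-- The translated state `e^{-i ε X} ρ e^{i ε X}`. -/
def translate (X : Observable H) (ρ : H →L[ℂ] H) (ε : ℝ) : H →L[ℂ] H :=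
  ((X.unitaryGroup (-ε)).toContinuousLinearEquiv : H →L[ℂ] H) ∘L ρ ∘L
    ((X.unitaryGroup ε).toContinuousLinearEquiv : H →L[ℂ] H)

/-- The quantum Fisher information (coherence) of `ρ` with respect to `X`, with values in
`[0, ∞]`: the limit of `4 D_F(e^{-iεX} ρ e^{iεX}, ρ)² / ε²` as `ε → 0`. It is written as a lower
limit, so that it has the right value whenever the limit exists, and is never a junk value. -/
def quantumFisherInfo (ρ : H →L[ℂ] H) (X : Observable H) : ℝ≥0∞ :=
  Filter.liminf (fun ε : ℝ => ENNReal.ofReal (4 * purifiedDistance (translate X ρ ε) ρ ^ 2 / ε ^ 2))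
    (𝓝[≠] 0)

end Reservoir

/-! ### Composite systems and implementations -/

section Composite

variable {a : Type*} [Fintype a]

/-- The composite system `ℂ^a ⊗ H`, i.e. the Hilbert space of `a`-indexed families in `H`;
the family `Ψ` stands for `∑ i, e_i ⊗ Ψ i`. -/
abbrev Composite (a : Type*) [Fintype a] (H : Type*) [NormedAddCommGroup H]
    [InnerProductSpace ℂ H] : Type _ :=
  PiLp 2 fun _ : a => H

variable {H : Type*} [NormedAddCommGroup H] [InnerProductSpace ℂ H]

/-- The product vector `v ⊗ ψ`. -/
def tmulVec (v : a → ℂ) (ψ : H) : Composite a H := WithLp.toLp 2 fun i => v i • ψ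

/-- The product operator `M ⊗ T`. -/
def tmulOp (M : Matrix a a ℂ) (T : H →L[ℂ] H) : Composite a H →ₗ[ℂ] Composite a H where
  toFun Ψ := WithLp.toLp 2 fun i => ∑ j, M i j • T (Ψ j)
  map_add' Ψ Φ := by
    ext i; simp [Finset.sum_add_distrib]
  map_smul' c Ψ := by
    ext i; simp [Finset.smul_sum, smul_comm c]

/-- The partial trace over `H`, with matrix elements
`⟨e_i| Tr_H T |e_j⟩ = ∑ k, ⟨e_i ⊗ b_k| T |e_j ⊗ b_k⟩`. -/
def partialTrace [DecidableEq a] [CompleteSpace H] (T : Composite a H →ₗ[ℂ] Composite a H) :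
    Matrix a a ℂ :=
  Matrix.of fun i j =>
    ∑' k, ⟪tmulVec (Pi.single i 1) (onb H k), T (tmulVec (Pi.single j 1) (onb H k))⟫_ℂ

/-- The total charge `X ⊗ 1 + 1 ⊗ Y` on `ℂ^a ⊗ H`, with domain `ℂ^a ⊗ dom Y`. -/
def totalCharge (X : Matrix a a ℂ) (Y : H →ₗ.[ℂ] H) : Composite a H →ₗ.[ℂ] Composite a H where
  domain :=
    { carrier := {Ψ | ∀ i, Ψ i ∈ Y.domain}
      add_mem' := fun hΨ hΦ i => Y.domain.add_mem (hΨ i) (hΦ i)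
      zero_mem' := fun _ => Y.domain.zero_mem
      smul_mem' := fun c _ hΨ i => Y.domain.smul_mem c (hΨ i) }
  toFun :=
    { toFun := fun Ψ => WithLp.toLp 2 fun i => (∑ j, X i j • Ψ.1 j) + Y ⟨Ψ.1 i, Ψ.2 i⟩
      map_add' := by
        rintro ⟨Ψ, hΨ⟩ ⟨Φ, hΦ⟩
        ext i
        have h := Y.map_add ⟨Ψ i, hΨ i⟩ ⟨Φ i, hΦ i⟩
        simp only [AddMemClass.mk_add_mk] at h
        simp only [AddMemClass.mk_add_mk, PiLp.add_apply, smul_add, Finset.sum_add_distrib, h]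
        abel
      map_smul' := by
        rintro c ⟨Ψ, hΨ⟩
        ext i
        have h := Y.map_smul c ⟨Ψ i, hΨ i⟩
        simp only [SetLike.mk_smul_mk] at h
        simp only [SetLike.mk_smul_mk, PiLp.smul_apply, RingHom.id_apply, smul_add,
          Finset.smul_sum, h, smul_comm c] }

/-- An implementation `(ρ_B, X_B, X_{B'}, U)` under the conservation law of `X` of the map `E` on
the system `A = ℂ^a`, whose charge is `X` before and after the process. The reservoir is in the
state `ρ_B`; the unitary `U : A ⊗ B → A ⊗ B'` satisfies
`U† (X ⊗ 1 + 1 ⊗ X_{B'}) U = X ⊗ 1 + 1 ⊗ X_B` (an equality of operators, domains included), and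
`E σ = Tr_{B'} [U (σ ⊗ ρ_B) U†]`. -/
structure Implementation [DecidableEq a] (X : Matrix a a ℂ)
    (E : Matrix a a ℂ →ₗ[ℂ] Matrix a a ℂ)
    (B : Type*) [NormedAddCommGroup B] [InnerProductSpace ℂ B] [CompleteSpace B]
    (B' : Type*) [NormedAddCommGroup B'] [InnerProductSpace ℂ B'] [CompleteSpace B'] where
  resource : B →L[ℂ] B
  isState : IsState resource
  charge : Observable B
  charge' : Observable B'
  U : Composite a B ≃ₗᵢ[ℂ] Composite a B'
  conservation : ∀ Ψ Φ : Composite a B,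
    (Ψ, Φ) ∈ (totalCharge X charge.op).graph ↔ (U Ψ, U Φ) ∈ (totalCharge X charge'.op).graph
  realizes : ∀ σ : Matrix a a ℂ,
    E σ = partialTrace (U.toLinearEquiv.toLinearMap ∘ₗ tmulOp σ resource ∘ₗ
      U.symm.toLinearEquiv.toLinearMap)

/-- `E` can be implemented exactly, under the conservation law of `X`, with a resource state of
finite coherence. -/
def ImplementableWithFiniteCoherence [DecidableEq a] (X : Matrix a a ℂ)
    (E : Matrix a a ℂ →ₗ[ℂ] Matrix a a ℂ) : Prop :=
  ∃ (B : Type u) (_ : NormedAddCommGroup B) (_ : InnerProductSpace ℂ B) (_ : CompleteSpace B)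
    (B' : Type v) (_ : NormedAddCommGroup B') (_ : InnerProductSpace ℂ B') (_ : CompleteSpace B')
    (I : Implementation X E B B'), quantumFisherInfo I.resource I.charge < ∞

end Composite

end ConservedChannel

end

/-! Put `y_j = U† x_j`, so that `N ∘ conjMap U` sends `|y_j⟩⟨y_j|` to the pure state `|x_j⟩⟨x_j|`. A
pure output cannot be correlated with the reservoir: for `ψ` in the range of `√ρ_B`, the
implementing unitary `V` maps `y_j ⊗ ψ` to a product `x_j ⊗ χ_j`
(`Implementation.contractCLM_eq_zero`, `eq_tmulVec_of_contract_eq_zero`). Conservation of charge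
makes `V` intertwine the evolutions `e^{itX} ⊗ e^{itX_B}` and `e^{itX} ⊗ e^{itX_{B'}}`
(`inner_evolution_eq`).

The eigenvectors `x₁`, `x₂` stay orthogonal under `e^{itX}`, hence `⟨y₁|e^{itX}|y₂⟩ ⟨ψ|e^{itX_B}|ψ⟩
= 0` for all `t`. For small `t` the second factor is close to `‖ψ‖² ≠ 0`. The first has derivative
`i⟨y₁|X|y₂⟩ = i⟨x₁|UXU†|x₂⟩ ≠ 0` at `0`, so it cannot vanish near `0`: a contradiction
(`Implementation.inner_charge_eq_zero`). Claim (2) then only requires dephasing to be a channel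
fixing eigenstates of `X`. -/

namespace ConservedChannel

/-! ### Dephasing is a channel that fixes the eigenstates of the charge -/

section Dephasing

variable {a : Type*} [Fintype a]

lemma conjMap_ketBra (V : Matrix a a ℂ) (x : a → ℂ) :
    conjMap V (ketBra x) = ketBra (V *ᵥ x) := by
  change V * ketBra x * Vᴴ = _
  rw [ketBra, ketBra, Matrix.mul_vecMulVec, Matrix.vecMulVec_mul, Matrix.star_mulVec]

/-- Amplifying a conjugation by `P` gives the conjugation by `1 ⊗ P`; this is how a Kraus form
yields complete positivity. -/
lemma amplify_conj (k : ℕ) (P : Matrix a a ℂ) (M : Matrix (Fin k × a) (Fin k × a) ℂ)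
    (p q : Fin k × a) :
    (P * (Matrix.of fun x y => M (p.1, x) (q.1, y)) * Pᴴ) p.2 q.2 =
      (Matrix.kronecker (1 : Matrix (Fin k) (Fin k) ℂ) P * M *
        (Matrix.kronecker (1 : Matrix (Fin k) (Fin k) ℂ) P)ᴴ) p q := by
  simp [Matrix.mul_apply, Fintype.sum_prod_type, Matrix.kroneckerMap_apply, Matrix.one_apply,
    Finset.sum_mul, ite_mul, apply_ite]

variable [DecidableEq a]

lemma toEuclideanCLM_eigenProjection (X : Matrix a a ℂ) (μ : ℂ) :
    Matrix.toEuclideanCLM (n := a) (𝕜 := ℂ) (eigenProjection X μ) =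
      (Module.End.eigenspace (Matrix.toEuclideanLin X) μ).starProjection :=
  StarAlgEquiv.apply_symm_apply _ _

lemma eigenProjection_isHermitian (X : Matrix a a ℂ) (μ : ℂ) :
    (eigenProjection X μ).IsHermitian := by
  have h : IsSelfAdjoint (Module.End.eigenspace (Matrix.toEuclideanLin X) μ).starProjection :=
    isSelfAdjoint_starProjection _
  apply EquivLike.injective (Matrix.toEuclideanCLM (n := a) (𝕜 := ℂ))
  rw [← Matrix.star_eq_conjTranspose]
  refine (map_star (Matrix.toEuclideanCLM (n := a) (𝕜 := ℂ)) _).trans ?_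
  rw [toEuclideanCLM_eigenProjection]
  exact h.star_eq

lemma eigenProjection_mul_self (X : Matrix a a ℂ) (μ : ℂ) :
    eigenProjection X μ * eigenProjection X μ = eigenProjection X μ := by
  apply EquivLike.injective (Matrix.toEuclideanCLM (n := a) (𝕜 := ℂ))
  rw [map_mul, toEuclideanCLM_eigenProjection]
  exact Submodule.isIdempotentElem_starProjection _

lemma eigenProjection_mulVec {X : Matrix a a ℂ} (hX : X.IsHermitian) {v : a → ℂ} {ν : ℂ}
    (hv : X *ᵥ v = ν • v) (μ : ℂ) :
    eigenProjection X μ *ᵥ v = if μ = ν then v else 0 := by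
  have hmem : WithLp.toLp 2 v ∈ Module.End.eigenspace (Matrix.toEuclideanLin X) ν := by
    rw [Module.End.mem_eigenspace_iff, Matrix.toLpLin_toLp, Matrix.toLin'_apply, hv]
    rfl
  have key : WithLp.toLp 2 (eigenProjection X μ *ᵥ v) =
      (Module.End.eigenspace (Matrix.toEuclideanLin X) μ).starProjection (WithLp.toLp 2 v) := by
    rw [← toEuclideanCLM_eigenProjection, Matrix.toEuclideanCLM_toLp]
  apply WithLp.toLp_injective 2
  rw [key]
  split_ifs with h
  · subst h
    exact Submodule.starProjection_eq_self_iff.2 hmem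
  · rw [WithLp.toLp_zero, Submodule.starProjection_apply_eq_zero_iff,
      Submodule.mem_orthogonal]
    intro w hw
    have hsym : (Matrix.toEuclideanLin X).IsSymmetric :=
      Matrix.isSymmetric_toEuclideanLin_iff.2 hX
    exact hsym.orthogonalFamily_eigenspaces h ⟨w, hw⟩ ⟨_, hmem⟩

lemma mem_roots_charpoly {X : Matrix a a ℂ} {v : a → ℂ} {ν : ℂ} (hv : X *ᵥ v = ν • v)
    (h0 : v ≠ 0) : ν ∈ X.charpoly.roots := by
  rw [Polynomial.mem_roots X.charpoly_monic.ne_zero, ← Matrix.charpoly_toLin',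
    ← Module.End.hasEigenvalue_iff_isRoot_charpoly]
  refine Module.End.hasEigenvalue_of_hasEigenvector (x := v) ⟨?_, h0⟩
  rw [Module.End.mem_eigenspace_iff, Matrix.toLin'_apply, hv]

-- Spectral theorem: each vector of an orthonormal eigenbasis is fixed by the projection for its own
-- eigenvalue and killed by the others.
open scoped Classical in
lemma sum_eigenProjection {X : Matrix a a ℂ} (hX : X.IsHermitian) :
    ∑ μ ∈ X.charpoly.roots.toFinset, eigenProjection X μ = 1 := by
  set P := ∑ μ ∈ X.charpoly.roots.toFinset, eigenProjection X μ with hP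
  have hv : ∀ j, P *ᵥ (hX.eigenvectorBasis j : a → ℂ) = hX.eigenvectorBasis j := by
    intro j
    have hj : X *ᵥ (hX.eigenvectorBasis j : a → ℂ) =
        (hX.eigenvalues j : ℂ) • (hX.eigenvectorBasis j : a → ℂ) :=
      hX.mulVec_eigenvectorBasis j
    have h0 : (hX.eigenvectorBasis j : a → ℂ) ≠ 0 := fun h =>
      hX.eigenvectorBasis.orthonormal.ne_zero j (by ext i; exact congrFun h i)
    have hm := mem_roots_charpoly hj h0
    rw [hP, Matrix.sum_mulVec]
    simp only [eigenProjection_mulVec hX hj]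
    rw [Finset.sum_ite_eq' _ _ (fun _ => (hX.eigenvectorBasis j : a → ℂ)),
      if_pos (Multiset.mem_toFinset.2 hm)]
  apply EquivLike.injective (Matrix.toEuclideanCLM (n := a) (𝕜 := ℂ))
  apply ContinuousLinearMap.coe_injective
  refine hX.eigenvectorBasis.toBasis.ext fun j => ?_
  simp only [OrthonormalBasis.coe_toBasis, map_one]
  ext i
  exact congrFun (hv j) i

open scoped Classical in
lemma dephasing_apply (X M : Matrix a a ℂ) :
    dephasing X M =
      ∑ μ ∈ X.charpoly.roots.toFinset, eigenProjection X μ * M * eigenProjection X μ := rfl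

open scoped Classical in
lemma dephasing_ketBra {X : Matrix a a ℂ} (hX : X.IsHermitian) {v : a → ℂ} {ν : ℂ}
    (hv : X *ᵥ v = ν • v) : dephasing X (ketBra v) = ketBra v := by
  have h : ∀ μ, eigenProjection X μ * ketBra v * eigenProjection X μ =
      if μ = ν then ketBra v else 0 := fun μ => by
    have := conjMap_ketBra (eigenProjection X μ) v
    change eigenProjection X μ * ketBra v * (eigenProjection X μ)ᴴ = _ at this
    rw [(eigenProjection_isHermitian X μ).eq, eigenProjection_mulVec hX hv] at this
    rw [this]
    split_ifs with h
    · rfl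
    · simp [ketBra]
  rw [dephasing_apply]
  simp only [h]
  -- For `v = 0` the number `ν` need not be an eigenvalue, so it may be absent from the sum.
  by_cases h0 : v = 0
  · simp [h0, ketBra]
  · rw [Finset.sum_ite_eq' _ _ (fun _ => ketBra v),
      if_pos (Multiset.mem_toFinset.2 (mem_roots_charpoly hv h0))]

-- The Hermitian projections `Π_μ` are Kraus operators, and the trace is preserved because `∑ Π_μ² =
-- ∑ Π_μ = 1`.
open scoped Classical in
lemma dephasing_isChannel {X : Matrix a a ℂ} (hX : X.IsHermitian) : IsChannel (dephasing X) where
  completelyPositive k M hM := by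
    have h : amplify k (dephasing X) M = ∑ μ ∈ X.charpoly.roots.toFinset,
        (Matrix.kronecker (1 : Matrix (Fin k) (Fin k) ℂ) (eigenProjection X μ) * M *
          (Matrix.kronecker (1 : Matrix (Fin k) (Fin k) ℂ) (eigenProjection X μ))ᴴ) := by
      ext p q
      rw [amplify, Matrix.of_apply, dephasing_apply, Matrix.sum_apply, Matrix.sum_apply]
      refine Finset.sum_congr rfl fun μ _ => ?_
      rw [← amplify_conj, (eigenProjection_isHermitian X μ).eq]
    rw [h]
    exact Matrix.posSemidef_sum _ fun μ _ => hM.mul_mul_conjTranspose_same _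
  tracePreserving M := by
    rw [dephasing_apply, Matrix.trace_sum]
    have h : ∀ μ, (eigenProjection X μ * M * eigenProjection X μ).trace =
        (eigenProjection X μ * M).trace := fun μ => by
      rw [Matrix.trace_mul_comm, ← Matrix.mul_assoc, eigenProjection_mul_self]
    simp only [h]
    rw [← Matrix.trace_sum, ← Finset.sum_mul, sum_eigenProjection hX, one_mul]

end Dephasing

/-! ### The unitary group of an unbounded observable -/

section UnitaryGroup

variable {H : Type*} [NormedAddCommGroup H] [InnerProductSpace ℂ H] [CompleteSpace H]

lemma Observable.unitaryGroup_zero (X : Observable H) (ψ : H) : X.unitaryGroup 0 ψ = ψ := by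
  have h := X.unitaryGroup_add 0 0 ψ
  rw [add_zero] at h
  exact ((X.unitaryGroup 0).injective h).symm

lemma Observable.unitaryGroup_neg (X : Observable H) (t : ℝ) (ψ : H) :
    X.unitaryGroup t (X.unitaryGroup (-t) ψ) = ψ := by
  rw [← X.unitaryGroup_add, add_neg_cancel, X.unitaryGroup_zero]

/-- The group is commutative, so it commutes with its own generator. This carries the derivative
from time `0`, where `generator` describes it, to every time. -/
lemma Observable.unitaryGroup_mem_graph (X : Observable H) {ψ φ : H} (h : (ψ, φ) ∈ X.op.graph)
    (t : ℝ) : (X.unitaryGroup t ψ, X.unitaryGroup t φ) ∈ X.op.graph := by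
  rw [X.generator] at h ⊢
  have h1 := ((X.unitaryGroup t).toContinuousLinearEquiv.toContinuousLinearMap.restrictScalars
    ℝ).hasFDerivAt.comp_hasDerivAt (0 : ℝ) h
  have h2 : HasDerivAt (fun s : ℝ => X.unitaryGroup t (X.unitaryGroup s ψ))
      (X.unitaryGroup t (Complex.I • φ)) 0 := h1
  rw [map_smul] at h2
  refine h2.congr_of_eventuallyEq (Filter.Eventually.of_forall fun s => ?_)
  change X.unitaryGroup s (X.unitaryGroup t ψ) = X.unitaryGroup t (X.unitaryGroup s ψ)
  rw [← X.unitaryGroup_add, ← X.unitaryGroup_add, add_comm]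

lemma Observable.hasDerivAt_unitaryGroup (X : Observable H) {ψ φ : H}
    (h : (ψ, φ) ∈ X.op.graph) (t : ℝ) :
    HasDerivAt (fun s : ℝ => X.unitaryGroup s ψ) (Complex.I • X.unitaryGroup t φ) t := by
  have h1 := (X.generator _ _).1 (X.unitaryGroup_mem_graph h t)
  rw [← sub_self t] at h1
  have h2 := h1.comp_sub_const t t
  refine h2.congr_of_eventuallyEq (Filter.Eventually.of_forall fun s => ?_)
  change X.unitaryGroup s ψ = X.unitaryGroup (s - t) (X.unitaryGroup t ψ)
  rw [← X.unitaryGroup_add, sub_add_cancel]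

lemma Observable.inner_op_symm (X : Observable H) {ψ φ ψ' φ' : H} (h : (ψ, φ) ∈ X.op.graph)
    (h' : (ψ', φ') ∈ X.op.graph) : ⟪φ, ψ'⟫_ℂ = ⟪ψ, φ'⟫_ℂ := by
  obtain ⟨p, hp, hp'⟩ := (LinearPMap.mem_graph_iff _).1 h
  obtain ⟨q, hq, hq'⟩ := (LinearPMap.mem_graph_iff _).1 h'
  have hd := X.selfAdjoint.dense_domain
  have hadj := LinearPMap.adjoint_isFormalAdjoint hd
  rw [LinearPMap.isSelfAdjoint_def.1 X.selfAdjoint] at hadj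
  have := hadj p q
  simp only at hp hp' hq hq'
  rwa [hp', hq', hp, hq] at this

end UnitaryGroup

/-! ### Product vectors and partial contractions -/

section ProductVectors

variable {a : Type*} [Fintype a]
variable {H : Type*} [NormedAddCommGroup H] [InnerProductSpace ℂ H]

/-- The map `ψ ↦ v ⊗ ψ`. -/
def tmulCLM (v : a → ℂ) : H →L[ℂ] Composite a H where
  toFun ψ := tmulVec v ψ
  map_add' ψ φ := by ext i; simp [tmulVec]
  map_smul' c ψ := by ext i; simp [tmulVec, smul_comm c]
  cont := by unfold tmulVec; fun_prop

/-- The map `⟨v| ⊗ 1`, the adjoint of `ψ ↦ v ⊗ ψ`. -/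
def contractCLM (v : a → ℂ) : Composite a H →L[ℂ] H where
  toFun Ψ := ∑ i, star (v i) • Ψ i
  map_add' Ψ Φ := by simp [Finset.sum_add_distrib]
  map_smul' c Ψ := by simp [Finset.smul_sum, smul_comm c]
  cont := by fun_prop

lemma contractCLM_apply (v : a → ℂ) (Ψ : Composite a H) :
    contractCLM v Ψ = ∑ i, star (v i) • Ψ i := rfl

lemma inner_tmulVec_left (v : a → ℂ) (ψ : H) (Ψ : Composite a H) :
    ⟪tmulVec v ψ, Ψ⟫_ℂ = ⟪ψ, contractCLM v Ψ⟫_ℂ := by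
  simp [PiLp.inner_apply, tmulVec, contractCLM_apply, inner_smul_left]

lemma inner_tmulVec_right (v : a → ℂ) (ψ : H) (Ψ : Composite a H) :
    ⟪Ψ, tmulVec v ψ⟫_ℂ = ⟪contractCLM v Ψ, ψ⟫_ℂ := by
  rw [← inner_conj_symm, inner_tmulVec_left, inner_conj_symm]

lemma contractCLM_tmulVec (v w : a → ℂ) (ψ : H) :
    contractCLM v (tmulVec w ψ) = (star v ⬝ᵥ w) • ψ := by
  simp [contractCLM_apply, tmulVec, dotProduct, Finset.sum_smul, smul_smul]

lemma inner_tmulVec_tmulVec (v w : a → ℂ) (ψ φ : H) :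
    ⟪tmulVec v ψ, tmulVec w φ⟫_ℂ = (star v ⬝ᵥ w) * ⟪ψ, φ⟫_ℂ := by
  rw [inner_tmulVec_left, contractCLM_tmulVec, inner_smul_right]

lemma tmulVec_smul (c : ℂ) (v : a → ℂ) (ψ : H) : tmulVec (c • v) ψ = c • tmulVec v ψ := by
  ext i; simp [tmulVec, smul_smul]

lemma tmulVec_sum {ι : Type*} (s : Finset ι) (f : ι → a → ℂ) (ψ : H) :
    tmulVec (∑ i ∈ s, f i) ψ = ∑ i ∈ s, tmulVec (f i) ψ := by
  ext i; simp [tmulVec, Finset.sum_smul]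

lemma tmulOp_ketBra (v : a → ℂ) (T : H →L[ℂ] H) (Ψ : Composite a H) :
    tmulOp (ketBra v) T Ψ = tmulVec v (T (contractCLM v Ψ)) := by
  ext i
  simp [tmulOp, ketBra, tmulVec, contractCLM_apply, Matrix.vecMulVec_apply, Finset.smul_sum,
    smul_smul]

/-- A vector orthogonal to `w ⊗ φ` for all `w ⊥ x` is of the form `x ⊗ χ`. -/
lemma eq_tmulVec_of_contract_eq_zero {x : a → ℂ} (hx : star x ⬝ᵥ x = 1) {Ψ : Composite a H}
    (h : ∀ w : a → ℂ, star x ⬝ᵥ w = 0 → contractCLM w Ψ = 0) :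
    Ψ = tmulVec x (contractCLM x Ψ) := by
  classical
  ext i
  -- The test vector is `e_i` minus its projection onto `x`; contracting with it gives component `i`
  -- of `Ψ - x ⊗ ⟨x|Ψ⟩`.
  have h1 := h (Pi.single i 1 - star (x i) • x) (by
    rw [dotProduct_sub, dotProduct_smul, hx]; simp)
  have h2 : contractCLM (Pi.single i 1 - star (x i) • x) Ψ = Ψ i - x i • contractCLM x Ψ := by
    simp [contractCLM_apply, sub_smul, Finset.sum_sub_distrib, Finset.smul_sum, smul_smul,
      Pi.single_apply, apply_ite, ite_smul]
  rw [h2] at h1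
  exact sub_eq_zero.1 h1

lemma hasDerivAt_tmulVec {y : ℝ → a → ℂ} {f : ℝ → H} {y' : a → ℂ} {f' : H} {t : ℝ}
    (hy : HasDerivAt y y' t) (hf : HasDerivAt f f' t) :
    HasDerivAt (fun s => tmulVec (y s) (f s)) (tmulVec y' (f t) + tmulVec (y t) f') t := by
  have h1 : HasDerivAt (fun s i => y s i • f s) (fun i => y' i • f t + y t i • f') t := by
    rw [hasDerivAt_pi]
    intro i
    rw [add_comm]
    exact ((hasDerivAt_pi.1 hy) i).smul hf
  exact ((PiLp.continuousLinearEquiv 2 ℝ (fun _ : a => H)).symm.toContinuousLinearMap.hasFDerivAt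
    (x := fun i => y t i • f t)).comp_hasDerivAt t h1

end ProductVectors

/-! ### From conservation of charge to intertwined time evolutions -/

section Conservation

variable {a : Type*} [Fintype a]
variable {H : Type*} [NormedAddCommGroup H] [InnerProductSpace ℂ H]

lemma totalCharge_apply (X : Matrix a a ℂ) (Y : H →ₗ.[ℂ] H) (p : (totalCharge X Y).domain)
    (i : a) : totalCharge X Y p i = (∑ j, X i j • (p : Composite a H) j) +
      Y ⟨(p : Composite a H) i, p.2 i⟩ := rfl

lemma tmulVec_mem_graph_totalCharge (X : Matrix a a ℂ) {Y : H →ₗ.[ℂ] H} {ψ φ : H}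
    (h : (ψ, φ) ∈ Y.graph) (y : a → ℂ) :
    (tmulVec y ψ, tmulVec (X *ᵥ y) ψ + tmulVec y φ) ∈ (totalCharge X Y).graph := by
  obtain ⟨p, hp, hp'⟩ := (LinearPMap.mem_graph_iff _).1 h
  simp only at hp hp'
  subst hp hp'
  refine (LinearPMap.mem_graph_iff _).2
    ⟨⟨tmulVec y p, fun i => Y.domain.smul_mem (y i) p.2⟩, rfl, ?_⟩
  ext i
  have h2 : Y ⟨y i • (p : H), Y.domain.smul_mem (y i) p.2⟩ = y i • Y p := Y.map_smul (y i) p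
  simp [totalCharge, tmulVec, Matrix.mulVec, dotProduct, Finset.sum_smul, smul_smul]
  exact h2

lemma inner_totalCharge_symm [CompleteSpace H] {X : Matrix a a ℂ} (hX : X.IsHermitian)
    (Y : Observable H)
    {Ψ Φ Ψ' Φ' : Composite a H} (h : (Ψ, Φ) ∈ (totalCharge X Y.op).graph)
    (h' : (Ψ', Φ') ∈ (totalCharge X Y.op).graph) : ⟪Φ, Ψ'⟫_ℂ = ⟪Ψ, Φ'⟫_ℂ := by
  obtain ⟨p, hp, hp'⟩ := (LinearPMap.mem_graph_iff _).1 h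
  obtain ⟨q, hq, hq'⟩ := (LinearPMap.mem_graph_iff _).1 h'
  simp only at hp hp' hq hq'
  subst hp hp' hq hq'
  simp only [PiLp.inner_apply, totalCharge_apply, inner_add_left, inner_add_right, sum_inner, inner_sum, inner_smul_left, inner_smul_right,
    Finset.sum_add_distrib]
  congr 1
  · rw [Finset.sum_comm]
    refine Finset.sum_congr rfl fun i _ => Finset.sum_congr rfl fun j _ => ?_
    rw [← hX.apply i j]
    rfl
  · exact Finset.sum_congr rfl fun i _ =>
      Y.inner_op_symm (Y.op.mem_graph ⟨_, p.2 i⟩) (Y.op.mem_graph ⟨_, q.2 i⟩)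

variable [CompleteSpace H] {H' : Type*} [NormedAddCommGroup H'] [InnerProductSpace ℂ H']
  [CompleteSpace H']

/-- A charge-preserving unitary intertwines the time evolutions generated by the total charges. -/
lemma inner_evolution_eq {X : Matrix a a ℂ} (hX : X.IsHermitian) (Y : Observable H)
    (Y' : Observable H') (U : Composite a H ≃ₗᵢ[ℂ] Composite a H')
    (hU : ∀ Ψ Φ : Composite a H,
      (Ψ, Φ) ∈ (totalCharge X Y.op).graph → (U Ψ, U Φ) ∈ (totalCharge X Y'.op).graph)
    {x y : ℝ → a → ℂ} (hx : ∀ t, HasDerivAt x (Complex.I • X *ᵥ x t) t)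
    (hy : ∀ t, HasDerivAt y (Complex.I • X *ᵥ y t) t) (t : ℝ) (φ : H') (ψ : H) :
    ⟪tmulVec (x t) (Y'.unitaryGroup t φ), U (tmulVec (y t) (Y.unitaryGroup t ψ))⟫_ℂ =
      ⟪tmulVec (x 0) φ, U (tmulVec (y 0) ψ)⟫_ℂ := by
  -- On the domains the inner product is differentiable in `t`. Its derivative vanishes because `U`
  -- carries one total charge to the other, which is symmetric.
  have hdom : ∀ φ ∈ Y'.op.domain, ∀ ψ ∈ Y.op.domain,
      ⟪tmulVec (x t) (Y'.unitaryGroup t φ), U (tmulVec (y t) (Y.unitaryGroup t ψ))⟫_ℂ =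
        ⟪tmulVec (x 0) φ, U (tmulVec (y 0) ψ)⟫_ℂ := by
    intro φ hφ ψ hψ
    have gφ : (φ, Y'.op ⟨φ, hφ⟩) ∈ Y'.op.graph := Y'.op.mem_graph ⟨φ, hφ⟩
    have gψ : (ψ, Y.op ⟨ψ, hψ⟩) ∈ Y.op.graph := Y.op.mem_graph ⟨ψ, hψ⟩
    set φ' := Y'.op ⟨φ, hφ⟩
    set ψ' := Y.op ⟨ψ, hψ⟩
    have hd : ∀ s : ℝ, HasDerivAt (fun s : ℝ => ⟪tmulVec (x s) (Y'.unitaryGroup s φ),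
        U (tmulVec (y s) (Y.unitaryGroup s ψ))⟫_ℂ) 0 s := by
      intro s
      have d1 := hasDerivAt_tmulVec (hx s) (Y'.hasDerivAt_unitaryGroup gφ s)
      have d2 := hasDerivAt_tmulVec (hy s) (Y.hasDerivAt_unitaryGroup gψ s)
      have d3 : HasDerivAt (fun s : ℝ => U (tmulVec (y s) (Y.unitaryGroup s ψ))) _ s :=
        (U.toContinuousLinearEquiv.toContinuousLinearMap.restrictScalars
          ℝ).hasFDerivAt.comp_hasDerivAt s d2
      refine (d1.inner ℂ d3).congr_deriv ?_
      have g1 := tmulVec_mem_graph_totalCharge X (Y'.unitaryGroup_mem_graph gφ s) (x s)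
      have g2 := hU _ _ (tmulVec_mem_graph_totalCharge X (Y.unitaryGroup_mem_graph gψ s) (y s))
      have key := inner_totalCharge_symm hX Y' g1 g2
      change ⟪_, U _⟫_ℂ + ⟪_, U _⟫_ℂ = 0
      have e1 : ∀ (v : a → ℂ) (χ : H), tmulVec v (Complex.I • χ) = Complex.I • tmulVec v χ :=
        fun v χ => (tmulCLM v).map_smul _ _
      have e2 : ∀ (v : a → ℂ) (χ : H'), tmulVec v (Complex.I • χ) = Complex.I • tmulVec v χ :=
        fun v χ => (tmulCLM v).map_smul _ _
      rw [e1, e2, tmulVec_smul, tmulVec_smul, ← smul_add, ← smul_add, map_smul, inner_smul_left,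
        inner_smul_right, key, Complex.conj_I]
      ring
    have hc := is_const_of_deriv_eq_zero (fun s => (hd s).differentiableAt)
      (fun s => (hd s).deriv) t 0
    simpa only [Observable.unitaryGroup_zero] using hc
  -- Both sides are continuous in `φ` and in `ψ`, so density of the two domains removes the
  -- restrictions one at a time.
  have hdom2 : ∀ φ, ∀ ψ ∈ Y.op.domain,
      ⟪tmulVec (x t) (Y'.unitaryGroup t φ), U (tmulVec (y t) (Y.unitaryGroup t ψ))⟫_ℂ =
        ⟪tmulVec (x 0) φ, U (tmulVec (y 0) ψ)⟫_ℂ := by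
    intro φ ψ hψ
    refine congrFun (Continuous.ext_on Y'.selfAdjoint.dense_domain ?_ ?_
      fun φ hφ => hdom φ hφ ψ hψ) φ
    · exact ((tmulCLM (x t)).continuous.comp (Y'.unitaryGroup t).continuous).inner continuous_const
    · exact (tmulCLM (x 0)).continuous.inner continuous_const
  refine congrFun (Continuous.ext_on Y.selfAdjoint.dense_domain ?_ ?_
    fun ψ hψ => hdom2 φ ψ hψ) ψ
  · exact continuous_const.inner (U.continuous.comp
      ((tmulCLM (y t)).continuous.comp (Y.unitaryGroup t).continuous))
  · exact continuous_const.inner (U.continuous.comp (tmulCLM (y 0)).continuous)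

end Conservation

/-! ### Hilbert-Schmidt sums and square roots of states -/

section HilbertSchmidt

variable {H H' : Type*} [NormedAddCommGroup H] [InnerProductSpace ℂ H]
  [NormedAddCommGroup H'] [InnerProductSpace ℂ H']

/-- Parseval's identity. -/
lemma hasSum_norm_sq_inner {ι : Type*} (b : HilbertBasis ι ℂ H) (v : H) :
    HasSum (fun i => ‖⟪b i, v⟫_ℂ‖ ^ 2) (‖v‖ ^ 2) := by
  have h := (b.hasSum_inner_mul_inner v v).mapL Complex.reCLM
  have h1 : ∀ i, Complex.reCLM (⟪v, b i⟫_ℂ * ⟪b i, v⟫_ℂ) = ‖⟪b i, v⟫_ℂ‖ ^ 2 := fun i => by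
    rw [← inner_conj_symm, RCLike.conj_mul]
    norm_cast
  simp only [h1] at h
  convert h using 1
  exact (inner_self_eq_norm_sq (𝕜 := ℂ) v).symm

lemma summable_inner_of_norm_sq {ι : Type*} {f g : ι → H} (hf : Summable fun i => ‖f i‖ ^ 2)
    (hg : Summable fun i => ‖g i‖ ^ 2) : Summable fun i => ⟪f i, g i⟫_ℂ := by
  refine Summable.of_norm_bounded (hf.add hg) fun i => ?_
  have := norm_inner_le_norm (𝕜 := ℂ) (f i) (g i)
  nlinarith [sq_nonneg (‖f i‖ - ‖g i‖), sq_nonneg ‖f i‖, sq_nonneg ‖g i‖]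

variable [CompleteSpace H] [CompleteSpace H']

/-- If the adjoint of an operator is Hilbert-Schmidt, then so is the operator. -/
lemma summable_norm_sq_of_adjoint {ι κ : Type*} (b : HilbertBasis ι ℂ H) (c : HilbertBasis κ ℂ H')
    (T : H →L[ℂ] H') (h : Summable fun l => ‖ContinuousLinearMap.adjoint T (c l)‖ ^ 2) :
    Summable fun k => ‖T (b k)‖ ^ 2 := by
  have e : ∀ l k, ‖⟪b k, ContinuousLinearMap.adjoint T (c l)⟫_ℂ‖ ^ 2 =
      ‖⟪c l, T (b k)⟫_ℂ‖ ^ 2 := fun l k => by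
    rw [ContinuousLinearMap.adjoint_inner_right, ← inner_conj_symm, RCLike.norm_conj]
  -- The double series of squared matrix elements may be summed in either order; Parseval identifies
  -- the inner sums.
  have h1 : Summable fun p : κ × ι => ‖⟪c p.1, T (b p.2)⟫_ℂ‖ ^ 2 := by
    rw [summable_prod_of_nonneg fun _ => by positivity]
    have hs : ∀ l, HasSum (fun k => ‖⟪c l, T (b k)⟫_ℂ‖ ^ 2)
        (‖ContinuousLinearMap.adjoint T (c l)‖ ^ 2) := fun l => by
      simpa only [e] using hasSum_norm_sq_inner b (ContinuousLinearMap.adjoint T (c l))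
    exact ⟨fun l => (hs l).summable, by simpa only [(hs _).tsum_eq] using h⟩
  have h2 := ((summable_prod_of_nonneg fun _ => by positivity).1 h1.prod_symm).2
  simpa only [Prod.fst_swap, Prod.snd_swap, (hasSum_norm_sq_inner c _).tsum_eq] using h2

lemma sqrt_mul_sqrt_apply {ρ : H →L[ℂ] H} (hρ : ρ.IsPositive) (ψ : H) :
    CFC.sqrt ρ (CFC.sqrt ρ ψ) = ρ ψ :=
  congrArg (fun T : H →L[ℂ] H => T ψ)
    (CFC.sqrt_mul_sqrt_self ρ ((ContinuousLinearMap.nonneg_iff_isPositive ρ).2 hρ))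

lemma adjoint_sqrt (ρ : H →L[ℂ] H) :
    ContinuousLinearMap.adjoint (CFC.sqrt ρ) = CFC.sqrt ρ :=
  (IsSelfAdjoint.of_nonneg (CFC.sqrt_nonneg ρ)).star_eq

lemma inner_sqrt_sqrt {ρ : H →L[ℂ] H} (hρ : ρ.IsPositive) (ψ φ : H) :
    ⟪CFC.sqrt ρ ψ, CFC.sqrt ρ φ⟫_ℂ = ⟪ψ, ρ φ⟫_ℂ := by
  rw [← sqrt_mul_sqrt_apply hρ, ← ContinuousLinearMap.adjoint_inner_right, adjoint_sqrt]

lemma IsState.summable_norm_sq_sqrt {ρ : H →L[ℂ] H} (hρ : IsState ρ) :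
    Summable fun k => ‖CFC.sqrt ρ (onb H k)‖ ^ 2 := by
  have h := (hρ.trace_one.mapL Complex.reCLM).summable
  simp only [← inner_sqrt_sqrt hρ.isPositive] at h
  exact h.congr fun k => (inner_self_eq_norm_sq (𝕜 := ℂ) (CFC.sqrt ρ (onb H k)))

lemma IsState.exists_sqrt_ne_zero {ρ : H →L[ℂ] H} (hρ : IsState ρ) : ∃ ψ, CFC.sqrt ρ ψ ≠ 0 := by
  by_contra! h
  have h1 := hρ.trace_one
  simp only [← sqrt_mul_sqrt_apply hρ.isPositive, h, inner_zero_right] at h1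
  exact zero_ne_one (hasSum_zero.unique h1)

end HilbertSchmidt

/-! ### Pure outputs force product vectors; the contradiction with conservation -/

section Implementation

lemma hasDerivAt_eigenvector_evolution {a : Type*} [Fintype a] {X : Matrix a a ℂ} {x : a → ℂ} {l : ℝ}
    (hx : X *ᵥ x = (l : ℂ) • x) (t : ℝ) :
    HasDerivAt (fun t : ℝ => Complex.exp (Complex.I * l * t) • x)
      (Complex.I • X *ᵥ (Complex.exp (Complex.I * l * t) • x)) t := by
  have h1 : HasDerivAt (fun t : ℝ => Complex.exp (Complex.I * l * t))
      (Complex.exp (Complex.I * l * t) * (Complex.I * l * 1)) t :=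
    ((Complex.ofRealCLM.hasDerivAt (x := t)).const_mul (Complex.I * l)).cexp
  refine (h1.smul_const x).congr_deriv ?_
  rw [Matrix.mulVec_smul, hx, smul_smul, smul_smul]
  congr 1
  ring

variable {a : Type*} [Fintype a] [DecidableEq a]
variable {B : Type*} [NormedAddCommGroup B] [InnerProductSpace ℂ B] [CompleteSpace B]
  {B' : Type*} [NormedAddCommGroup B'] [InnerProductSpace ℂ B'] [CompleteSpace B']
  {X : Matrix a a ℂ} {E : Matrix a a ℂ →ₗ[ℂ] Matrix a a ℂ}

/-- If the implemented map sends `|y⟩⟨y|` to the pure state `|x⟩⟨x|`, then the implementing unitary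
sends `y ⊗ √ρ ψ` to vectors without component along any `w ⊥ x`. -/
lemma Implementation.contractCLM_eq_zero (I : Implementation X E B B') {x y w : a → ℂ}
    (hE : E (ketBra y) = ketBra x) (hw : star x ⬝ᵥ w = 0) (ψ : B) :
    contractCLM w (I.U (tmulVec y (CFC.sqrt I.resource ψ))) = 0 := by
  set R := CFC.sqrt I.resource with hR
  -- `A v = ⟨y| U† |v⟩`, so that `⟨v| E(|y⟩⟨y|) |v'⟩` is the Hilbert-Schmidt inner product of `√ρ A
  -- v` and `√ρ A v'`.
  let A (v : a → ℂ) : B' →L[ℂ] B :=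
    contractCLM y ∘L (I.U.symm.toContinuousLinearEquiv : Composite a B' →L[ℂ] Composite a B) ∘L
      tmulCLM v
  have hA : ∀ v φ, A v φ = contractCLM y (I.U.symm (tmulVec v φ)) := fun v φ => rfl
  have hinner : ∀ v v' φ φ', ⟪tmulVec v φ, (I.U.toLinearEquiv.toLinearMap ∘ₗ
      tmulOp (ketBra y) I.resource ∘ₗ I.U.symm.toLinearEquiv.toLinearMap) (tmulVec v' φ')⟫_ℂ =
      ⟪R (A v φ), R (A v' φ')⟫_ℂ := by
    intro v v' φ φ'
    change ⟪_, I.U (tmulOp (ketBra y) I.resource (I.U.symm (tmulVec v' φ')))⟫_ℂ = _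
    rw [← LinearIsometryEquiv.symm_symm I.U, ← LinearIsometryEquiv.inner_map_eq_flip,
      LinearIsometryEquiv.symm_symm, tmulOp_ketBra, inner_tmulVec_right,
      inner_sqrt_sqrt I.isState.isPositive, hA, hA]
  -- `partialTrace` is a `tsum`, which is `0` on divergent families, so convergence has to be shown.
  -- The adjoint `(A v)† √ρ` is Hilbert-Schmidt because `√ρ` is.
  have hsum : ∀ v, Summable fun k => ‖R (A v (onb B' k))‖ ^ 2 := by
    intro v
    refine summable_norm_sq_of_adjoint (onb B') (onb B) (R ∘L A v) ?_
    refine Summable.of_nonneg_of_le (fun _ => by positivity) (fun l => ?_)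
      (I.isState.summable_norm_sq_sqrt.mul_left (‖ContinuousLinearMap.adjoint (A v)‖ ^ 2))
    rw [ContinuousLinearMap.adjoint_comp, hR, adjoint_sqrt, ← mul_pow]
    exact pow_le_pow_left₀ (norm_nonneg _)
      (ContinuousLinearMap.le_opNorm (ContinuousLinearMap.adjoint (A v)) _) 2
  have hentry : ∀ i j, HasSum (fun k => ⟪R (A (Pi.single i 1) (onb B' k)),
      R (A (Pi.single j 1) (onb B' k))⟫_ℂ) (ketBra x i j) := by
    intro i j
    rw [← hE, I.realizes, partialTrace, Matrix.of_apply]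
    simp only [hinner]
    exact (summable_inner_of_norm_sq (hsum _) (hsum _)).hasSum
  have hAw : ∀ φ, R (A w φ) = ∑ i, w i • R (A (Pi.single i 1) φ) := by
    intro φ
    have h1 : tmulVec w φ = ∑ i, w i • tmulVec (Pi.single i 1) φ := by
      simp only [← tmulVec_smul, ← tmulVec_sum]
      congr 1
      ext j
      simp [Pi.single_apply]
    simp only [hA, h1, map_sum, map_smul]
  -- The sum equals `⟨w| E(|y⟩⟨y|) |w⟩ = |⟨x|w⟩|² = 0`; its terms are nonnegative, so each of them
  -- vanishes.
  have htot : HasSum (fun k => ⟪R (A w (onb B' k)), R (A w (onb B' k))⟫_ℂ) 0 := by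
    have h1 := hasSum_sum (s := Finset.univ) fun i _ => hasSum_sum (s := Finset.univ) fun j _ =>
      (hentry i j).mul_left (star (w i) * w j)
    have h0 : ∑ i, ∑ j, star (w i) * w j * ketBra x i j = 0 := by
      calc ∑ i, ∑ j, star (w i) * w j * ketBra x i j
          = ∑ i, star (w i) * x i * (star x ⬝ᵥ w) := by
            simp only [dotProduct, Finset.mul_sum, ketBra, Matrix.vecMulVec_apply]
            exact Finset.sum_congr rfl fun i _ => Finset.sum_congr rfl fun j _ => by ring
        _ = 0 := by simp [hw]
    rw [h0] at h1
    refine Eq.mp ?_ h1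
    congr 1
    funext k
    simp only [hAw, sum_inner, inner_sum, inner_smul_left, inner_smul_right, Finset.mul_sum]
    rw [Finset.sum_comm]
    exact Finset.sum_congr rfl fun i _ => Finset.sum_congr rfl fun j _ => by
      rw [RCLike.star_def]; ring
  have hzero : ∀ k, R (A w (onb B' k)) = 0 := by
    have h1 := htot.mapL Complex.reCLM
    have h2 : ∀ k, Complex.reCLM ⟪R (A w (onb B' k)), R (A w (onb B' k))⟫_ℂ =
        ‖R (A w (onb B' k))‖ ^ 2 := fun k => inner_self_eq_norm_sq (𝕜 := ℂ) _
    simp only [h2, map_zero] at h1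
    have h3 := (hasSum_zero_iff_of_nonneg fun _ => by positivity).1 h1
    intro k
    simpa using congrFun h3 k
  have hop : R ∘L A w = 0 := by
    refine ContinuousLinearMap.ext_on
      ((Submodule.dense_iff_topologicalClosure_eq_top).2 (onb B').dense_span) ?_
    rintro _ ⟨k, rfl⟩
    exact hzero k
  refine ext_inner_left ℂ fun φ => ?_
  have h1 : R (A w φ) = 0 := congrArg (fun T : B' →L[ℂ] B => T φ) hop
  rw [← inner_tmulVec_left, ← LinearIsometryEquiv.symm_symm I.U,
    ← LinearIsometryEquiv.inner_map_eq_flip, inner_tmulVec_right, ← hA, hR,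
    ← adjoint_sqrt, ContinuousLinearMap.adjoint_inner_right, h1]
  simp

/-- The curve is `e^{itX} v`. Unlike `x₁`, the vector `y₂` need not be an eigenvector of `X`, so a
scalar phase does not suffice. -/
lemma exists_evolution (X : Matrix a a ℂ) (v : a → ℂ) :
    ∃ y : ℝ → a → ℂ, y 0 = v ∧ ∀ t, HasDerivAt y (Complex.I • X *ᵥ y t) t := by
  let T := Matrix.toEuclideanCLM (n := a) (𝕜 := ℂ) (Complex.I • X)
  refine ⟨fun t => WithLp.ofLp (NormedSpace.exp (t • T) (WithLp.toLp 2 v)),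
    by simp [zero_smul ℝ T], fun t => ?_⟩
  have h1 := hasDerivAt_exp_smul_const' (𝕂 := ℝ) T t
  have h2 : HasDerivAt (fun t : ℝ => NormedSpace.exp (t • T) (WithLp.toLp 2 v))
      (T (NormedSpace.exp (t • T) (WithLp.toLp 2 v))) t :=
    ((ContinuousLinearMap.apply ℂ (EuclideanSpace ℂ a)
      (WithLp.toLp 2 v)).restrictScalars ℝ).hasFDerivAt.comp_hasDerivAt t h1
  have h3 := ((PiLp.continuousLinearEquiv 2 ℂ
    (fun _ : a => ℂ)).toContinuousLinearMap.restrictScalars ℝ).hasFDerivAt.comp_hasDerivAt t h2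
  refine h3.congr_deriv ?_
  rw [← Matrix.smul_mulVec]
  exact Matrix.ofLp_toEuclideanCLM _ _

/-- A Wigner-Araki-Yanase type theorem. A map that sends `|y₁⟩⟨y₁|`, `|y₂⟩⟨y₂|` to orthogonal pure eigenstates of the charge `X` has no
implementation under the conservation law of `X` unless `⟨y₁|X|y₂⟩ = 0`. For a vector `ψ` in the range
of `√ρ_B` the unitary sends `y_j ⊗ ψ` to product vectors `x_j ⊗ χ_j`, so conservation gives
`⟨y₁|e^{itX}|y₂⟩ ⟨ψ|e^{itX_B}|ψ⟩ = ⟨x₁|e^{itX}|x₂⟩ ⟨χ₁|e^{itX_{B'}}|χ₂⟩ = 0` for all `t`, while the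
first factor has derivative `i⟨y₁|X|y₂⟩` at `0` and the second one tends to `‖ψ‖² ≠ 0`. Since only
the unitary groups enter, nothing has to be assumed about the coherence of the resource. -/
theorem Implementation.inner_charge_eq_zero (hX : X.IsHermitian) (I : Implementation X E B B')
    {x₁ x₂ y₁ y₂ : a → ℂ} {l₁ : ℝ} (hx₁ : X *ᵥ x₁ = (l₁ : ℂ) • x₁) (hn₁ : star x₁ ⬝ᵥ x₁ = 1)
    (horth : star x₂ ⬝ᵥ x₁ = 0) (h₁ : E (ketBra y₁) = ketBra x₁)
    (h₂ : E (ketBra y₂) = ketBra x₂) : star y₁ ⬝ᵥ (X *ᵥ y₂) = 0 := by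
  by_contra hne
  obtain ⟨ψ₀, hψ₀⟩ := I.isState.exists_sqrt_ne_zero
  obtain ⟨y, hy0, hy⟩ := exists_evolution X y₂
  set ψ := CFC.sqrt I.resource ψ₀ with hψ
  have hχ := eq_tmulVec_of_contract_eq_zero hn₁
    (fun w hw => I.contractCLM_eq_zero h₁ hw ψ₀)
  rw [← hψ] at hχ
  set χ := contractCLM x₁ (I.U (tmulVec y₁ ψ))
  have hprod : ∀ t, (star y₁ ⬝ᵥ y t) * ⟪ψ, I.charge.unitaryGroup t ψ⟫_ℂ = 0 := by
    intro t
    -- Starting from `e^{-itX_{B'}} χ` makes the reservoir factor at time `t` equal to `χ`, so that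
    -- `x₁ ⊗ χ = U (y₁ ⊗ ψ)` applies there. At time `0` the product vanishes because `U (y₂ ⊗ ψ)`
    -- has no component along `x₁ ⊥ x₂`.
    have h := inner_evolution_eq hX I.charge I.charge' I.U (fun Ψ Φ => (I.conservation Ψ Φ).1)
      (hasDerivAt_eigenvector_evolution hx₁) hy t (I.charge'.unitaryGroup (-t) χ) ψ
    rw [inner_tmulVec_left _ (I.charge'.unitaryGroup (-t) χ), hy0] at h
    simp only [Complex.ofReal_zero, mul_zero, Complex.exp_zero, one_smul] at h
    rw [I.contractCLM_eq_zero h₂ horth ψ₀, inner_zero_right, Observable.unitaryGroup_neg,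
      tmulVec_smul, ← hχ, inner_smul_left, LinearIsometryEquiv.inner_map_map,
      inner_tmulVec_tmulVec] at h
    exact (mul_eq_zero.1 h).resolve_left (by simp [Complex.exp_ne_zero])
  have hd : HasDerivAt (fun t => star y₁ ⬝ᵥ y t) (Complex.I * (star y₁ ⬝ᵥ (X *ᵥ y₂))) 0 := by
    have h1 := HasDerivAt.fun_sum (u := Finset.univ) fun i _ =>
      ((hasDerivAt_pi.1 (hy 0)) i).const_mul (star y₁ i)
    refine h1.congr_deriv ?_
    rw [hy0, ← smul_eq_mul Complex.I, ← dotProduct_smul]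
    rfl
  -- A nonzero derivative keeps the overlap away from `0` at all small `t ≠ 0`, even if it vanishes
  -- at `t = 0`.
  have hev := hd.eventually_ne (c := 0) (mul_ne_zero Complex.I_ne_zero hne)
  have hcont : Continuous fun t => ⟪ψ, I.charge.unitaryGroup t ψ⟫_ℂ :=
    continuous_const.inner (I.charge.unitaryGroup_continuous ψ)
  have hev2 : ∀ᶠ t in 𝓝 (0 : ℝ), ⟪ψ, I.charge.unitaryGroup t ψ⟫_ℂ ≠ 0 := by
    refine hcont.continuousAt.eventually_ne ?_
    rw [Observable.unitaryGroup_zero]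
    exact inner_self_ne_zero.2 hψ₀
  obtain ⟨t, ht1, ht2⟩ := (hev.and (hev2.filter_mono nhdsWithin_le_nhds)).exists
  exact mul_ne_zero ht1 ht2 (hprod t)

theorem not_implementableWithFiniteCoherence_comp_conjMap (hX : X.IsHermitian) {U : Matrix a a ℂ}
    (hU : U ∈ Matrix.unitaryGroup a ℂ) {x₁ x₂ : a → ℂ} {l₁ : ℝ}
    (hx₁ : X *ᵥ x₁ = (l₁ : ℂ) • x₁) (hn₁ : star x₁ ⬝ᵥ x₁ = 1) (horth : star x₁ ⬝ᵥ x₂ = 0)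
    (hcoh : star x₁ ⬝ᵥ ((U * X * Uᴴ) *ᵥ x₂) ≠ 0) {N : Matrix a a ℂ →ₗ[ℂ] Matrix a a ℂ}
    (h₁ : N (ketBra x₁) = ketBra x₁) (h₂ : N (ketBra x₂) = ketBra x₂) :
    ¬ ImplementableWithFiniteCoherence.{u, v} X (N ∘ₗ conjMap U) := by
  rintro ⟨B, _, _, _, B', _, _, _, I, -⟩
  have hy : ∀ x, N (ketBra x) = ketBra x → (N ∘ₗ conjMap U) (ketBra (Uᴴ *ᵥ x)) = ketBra x := by
    intro x hx
    rw [LinearMap.comp_apply, conjMap_ketBra, Matrix.mulVec_mulVec, ← Matrix.star_eq_conjTranspose,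
      Matrix.mem_unitaryGroup_iff.1 hU, Matrix.one_mulVec, hx]
  have horth' : star x₂ ⬝ᵥ x₁ = 0 := by
    rw [Matrix.star_dotProduct, horth, star_zero]
  apply hcoh
  rw [← I.inner_charge_eq_zero hX hx₁ hn₁ horth' (hy x₁ h₁) (hy x₂ h₂), Matrix.star_mulVec,
    Matrix.conjTranspose_conjTranspose, ← Matrix.dotProduct_mulVec, Matrix.mulVec_mulVec,
    Matrix.mulVec_mulVec, Matrix.mul_assoc]

end Implementation

end ConservedChannel

open ConservedChannel in
theorem mainTheorem8 {a : Type*} [Fintype a] [DecidableEq a]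
    (X : Matrix a a ℂ) (hX : X.IsHermitian)
    (U : Matrix a a ℂ) (hU : U ∈ Matrix.unitaryGroup a ℂ)
    (x₁ x₂ : a → ℂ) (l₁ l₂ : ℝ)
    (hx₁ : X *ᵥ x₁ = (l₁ : ℂ) • x₁) (hx₂ : X *ᵥ x₂ = (l₂ : ℂ) • x₂)
    (hn₁ : star x₁ ⬝ᵥ x₁ = 1) (hn₂ : star x₂ ⬝ᵥ x₂ = 1) (horth : star x₁ ⬝ᵥ x₂ = 0)
    (hcoh : star x₁ ⬝ᵥ ((U * X * Uᴴ) *ᵥ x₂) ≠ 0) :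
    (∀ N : Matrix a a ℂ →ₗ[ℂ] Matrix a a ℂ, IsChannel N →
      N (ketBra x₁) = ketBra x₁ → N (ketBra x₂) = ketBra x₂ →
        ¬ ImplementableWithFiniteCoherence.{u, v} X (N ∘ₗ conjMap U)) ∧
    (IsChannel (dephasing X) ∧
      dephasing X (ketBra x₁) = ketBra x₁ ∧ dephasing X (ketBra x₂) = ketBra x₂ ∧
      ¬ ImplementableWithFiniteCoherence.{u, v} X (dephasing X ∘ₗ conjMap U)) := by
  refine ⟨fun N _ h₁ h₂ =>
    not_implementableWithFiniteCoherence_comp_conjMap hX hU hx₁ hn₁ horth hcoh h₁ h₂, ?_⟩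
  have h₁ := dephasing_ketBra hX hx₁
  have h₂ := dephasing_ketBra hX hx₂
  exact ⟨dephasing_isChannel hX, h₁, h₂,
    not_implementableWithFiniteCoherence_comp_conjMap hX hU hx₁ hn₁ horth hcoh h₁ h₂⟩
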